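/- Let $k\ge 0$ be an integer and put $r=\frac{3^k+1}{2}$. Graphs are simple graphs (finite or infinite), regarded as structures with one binary relation (adjacency). Write $G\equiv_k G'$ if $G$ and $G'$ satisfy the same first-order sentences of quantifier rank at most $k$. The logical class of a graph is its $\equiv_k$-class; for rooted graphs the root is added as a constant. Let $B_r(v)$ be the set of vertices at distance at most $r$ from $v$, and for a set $S$ of vertices let $B_r(S)=\bigcup_{v\in S}B_r(v)$; these sets also denote the subgraphs they induce. For a graph $G$ let $\mathbf C_{2r}(G)$ be the set of (vertex sets of) cycles of length at most $2r$ in $G$. Call two such cycles linked if they are joined by a finite chain of cycles in $\mathbf C_{2r}(G)$ in which consecutive cycles are at distance at most $r$. Let $\mathcal C(G)$ be the set of the unions of the classes of linked cycles (the isolated cycles and the multicycles of $G$). For a logical class $L$ let $\Lambda_L(G)\in\{0,1,2,\dots,\infty\}$ be the number of $S\in\mathcal C(G)$ such that the subgraph induced on $B_r(S)$ belongs to $L$. Let $\mathcal C_0(G)$ be the set of vertices $v$ such that $B_r(v)$ is disjoint from every cycle in $\mathbf C_{2r}(G)$. Suppose that $G$ and $G'$ have the same cycle profile, i.e. $\Lambda_L(G)=\Lambda_L(G')$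 for every logical class $L$. Suppose also that for each of the two graphs, $H\in\{G,G'\}$, and for the logical class $L$ of every rooted tree of depth at most $r$, there are at least $k$ distinct sets of the form $B_r(v)$ with $v\in\mathcal C_0(H)$ for which the induced subgraph rooted at $v$ belongs to $L$. Then $G\equiv_k G'$. -/

import Mathlib

universe u

open FirstOrder

namespace CycleProfile

/-! ### First-order logic of graphs: quantifier rank, logical types, `k`-elementary equivalence -/

/-- The quantifier rank of a formula. The primitive connectives are `⊥`, `→` and `∀`; negation is
`φ → ⊥` and `∃` is `¬∀¬`, so that all Boolean connectives take the maximum of the ranks and both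
quantifiers raise the rank by one. -/
def quantifierRank {L : Language} {α : Type*} : {n : ℕ} → L.BoundedFormula α n → ℕ
  | _, .falsum => 0
  | _, .equal _ _ => 0
  | _, .rel _ _ => 0
  | _, .imp φ ψ => max (quantifierRank φ) (quantifierRank ψ)
  | _, .all φ => quantifierRank φ + 1

/-- The sentence `φ` in the language of a single binary relation holds in the graph `G`. -/
def Satisfies {V : Type*} (G : SimpleGraph V) (φ : Language.graph.Sentence) : Prop :=
  letI := G.structure
  V ⊨ φ

/-- `G ≡ₖ G'`: the two graphs satisfy the same sentences of quantifier rank at most `k`. -/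
def ElemEquiv {V W : Type*} (k : ℕ) (G : SimpleGraph V) (G' : SimpleGraph W) : Prop :=
  ∀ φ : Language.graph.Sentence, quantifierRank φ ≤ k → (Satisfies G φ ↔ Satisfies G' φ)

/-- The logical type (the `≡ₖ`-class) of a graph, coded by the set of the sentences of quantifier
rank at most `k` that it satisfies. -/
def logicalType {V : Type*} (k : ℕ) (G : SimpleGraph V) : Set Language.graph.Sentence :=
  {φ | quantifierRank φ ≤ k ∧ Satisfies G φ}

/-- The logical type of a rooted graph: the root may be referred to by the formulas, as the value
of their only free variable (equivalently, as a constant). -/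
def rootedLogicalType {V : Type*} (k : ℕ) (G : SimpleGraph V) (root : V) :
    Set (Language.graph.Formula Unit) :=
  letI := G.structure
  {φ | quantifierRank φ ≤ k ∧ φ.Realize (fun _ => root)}

/-! ### Neighborhoods, cycles, multicycles -/

/-- The radius `(3 ^ k + 1) / 2`; the division is exact. -/
def radius (k : ℕ) : ℕ := (3 ^ k + 1) / 2

section
variable {V : Type*} (G : SimpleGraph V) (r : ℕ)

/-- The `r`-neighborhood of a vertex. -/
def ball (v : V) : Set V := {w | G.edist v w ≤ r}

/-- The `r`-neighborhood of a set of vertices. -/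
def setBall (S : Set V) : Set V := {w | ∃ v ∈ S, G.edist w v ≤ r}

/-- The cycles of length at most `2 * r`, each given by its set of vertices. -/
def shortCycles : Set (Set V) :=
  {C | ∃ (v : V) (p : G.Walk v v), p.IsCycle ∧ p.length ≤ 2 * r ∧ C = {x | x ∈ p.support}}

/-- Two short cycles at distance at most `r`. -/
def CyclesNear (C C' : Set V) : Prop :=
  C ∈ shortCycles G r ∧ C' ∈ shortCycles G r ∧ ∃ x ∈ C, ∃ y ∈ C', G.edist x y ≤ r

/-- Two short cycles joined by a finite chain of short cycles with consecutive distances at most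
`r`. -/
def CyclesLinked : Set V → Set V → Prop := Relation.ReflTransGen (CyclesNear G r)

/-- The isolated cycles and the multicycles: the unions of the classes of linked short cycles. A
class with one member gives an isolated cycle. -/
def cycleClusters : Set (Set V) :=
  {S | ∃ C ∈ shortCycles G r, S = ⋃₀ {C' | C' ∈ shortCycles G r ∧ CyclesLinked G r C C'}}

/-- The vertices whose `r`-neighborhood meets no short cycle. -/
def acyclicVertices : Set V := {v | ∀ C ∈ shortCycles G r, Disjoint (ball G r v) C}

end

/-! ### Cycle profile and tree neighborhoods, at the radius `radius k` -/

/-- The number of isolated cycles and multicycles whose `r`-neighborhood, as an induced subgraph,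
has the logical type `L`. -/
noncomputable def cycleCount {V : Type*} (k : ℕ) (G : SimpleGraph V)
    (L : Set Language.graph.Sentence) : ℕ∞ :=
  {S | S ∈ cycleClusters G (radius k) ∧
    logicalType k (G.induce (setBall G (radius k) S)) = L}.encard

/-- The two graphs have the same number of isolated cycles and multicycles of each logical type. -/
def SameCycleProfile {V W : Type*} (k : ℕ) (G : SimpleGraph V) (G' : SimpleGraph W) : Prop :=
  ∀ L : Set Language.graph.Sentence, cycleCount k G L = cycleCount k G' L

/-- The root of a ball, as a vertex of the subgraph induced on the ball. -/
def ballRoot {V : Type*} (G : SimpleGraph V) (r : ℕ) (v : V) : ball G r v :=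
  ⟨v, by simp [ball]⟩

/-- The distinct acyclic neighborhoods (as sets of vertices) that have the rooted logical
type `L`. -/
def treeNeighborhoods {V : Type*} (k : ℕ) (G : SimpleGraph V)
    (L : Set (Language.graph.Formula Unit)) : Set (Set V) :=
  {B | ∃ v ∈ acyclicVertices G (radius k), B = ball G (radius k) v ∧
    rootedLogicalType k (G.induce (ball G (radius k) v)) (ballRoot G (radius k) v) = L}

/-- For every rooted tree of depth at most `radius k`, the graph has at least `k` distinct
neighborhoods of its logical class. -/
def HasManyTrees {V : Type u} (k : ℕ) (G : SimpleGraph V) : Prop :=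
  ∀ (A : Type u) (T : SimpleGraph A) (t : A), T.IsTree → (∀ a, T.edist t a ≤ radius k) →
    (k : ℕ∞) ≤ (treeNeighborhoods k G (rootedLogicalType k T t)).encard

end CycleProfile

/-! Agreement on sentences of quantifier rank at most `k` follows from a win of Duplicator in the
Ehrenfeucht–Fraïssé game of `k` rounds. Each graph is compared with a model: the disjoint union of
the `r`-neighborhoods of its clusters (isolated cycles and multicycles) and of infinitely many trees
of every rooted type. The models of `G` and `G'` have equally many pieces of each class, since the
tree parts coincide and the cluster parts agree by the cycle profile; hence they are equivalent
(`EF.sigma`).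

It remains to compare a graph with its own model (`HasManyTrees.ef_model`). The game is started from
the position, possibly infinite, that pairs every vertex on a short cycle with its copy; extra pairs
only make Duplicator's task harder (`EF.mono`). Moves close to earlier vertices belong to a local
game. Initially it is won by copying inside each cluster neighborhood, and these games combine
because distinct clusters are more than `r ≥ 2 ^ k` apart (`LocalEF.iUnion`). A move far from all
earlier vertices sees only a tree of small depth around it, and is answered in a fresh component
equivalent to that tree (`TreeRich.ef`).

Such components exist in `G` because `k` rounds can bound depth by `2 ^ (k - 1) < r`: a ball of
radius `r` with the type of so shallow a tree is a whole component (`HasManyTrees.treeRich`). Thus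
`k` distinct balls are `k` disjoint components, and one of them avoids the fewer than `k` vertices
chosen in previous moves. -/

namespace CycleProfile

/-! ### Bounded distance -/

section Near
variable {V W : Type*} {G : SimpleGraph V} {H : SimpleGraph W}

/-- The vertices `x` and `y` are joined by a walk of length at most `n`. -/
def Near (G : SimpleGraph V) (n : ℕ) (x y : V) : Prop := ∃ p : G.Walk x y, p.length ≤ n

theorem edist_le_iff_near {n : ℕ} {x y : V} : G.edist x y ≤ n ↔ Near G n x y := by
  constructor
  · intro h
    have hr : G.Reachable x y := by
      rw [← SimpleGraph.edist_ne_top_iff_reachable]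
      exact ne_top_of_le_ne_top (ENat.natCast_ne_top n) h
    obtain ⟨p, hp⟩ := hr.exists_walk_length_eq_edist
    exact ⟨p, by rw [← hp] at h; exact_mod_cast h⟩
  · rintro ⟨p, hp⟩
    exact (SimpleGraph.edist_le p).trans (by exact_mod_cast hp)

theorem Near.refl (n : ℕ) (x : V) : Near G n x x := ⟨.nil, by simp⟩

theorem Near.symm {n : ℕ} {x y : V} (h : Near G n x y) : Near G n y x := by
  obtain ⟨p, hp⟩ := h
  exact ⟨p.reverse, by simpa using hp⟩

theorem Near.mono {m n : ℕ} {x y : V} (h : Near G m x y) (hmn : m ≤ n) : Near G n x y := by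
  obtain ⟨p, hp⟩ := h
  exact ⟨p, hp.trans hmn⟩

theorem Near.trans {m n l : ℕ} {x y z : V} (h : Near G m x y) (h' : Near G n y z)
    (hl : m + n ≤ l) : Near G l x z := by
  obtain ⟨p, hp⟩ := h
  obtain ⟨q, hq⟩ := h'
  exact ⟨p.append q, by rw [SimpleGraph.Walk.length_append]; omega⟩

theorem _root_.SimpleGraph.Adj.near {x y : V} (h : G.Adj x y) : Near G 1 x y :=
  ⟨h.toWalk, by simp⟩

theorem near_one_iff {x y : V} : Near G 1 x y ↔ x = y ∨ G.Adj x y := by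
  rw [← edist_le_iff_near, Nat.cast_one, SimpleGraph.edist_le_one_iff_adj_or_eq, or_comm]

theorem Near.split {m n : ℕ} {x z : V} (h : Near G (m + n) x z) :
    ∃ y, Near G m x y ∧ Near G n y z := by
  obtain ⟨p, hp⟩ := h
  exact ⟨p.getVert m, ⟨p.take m, by rw [SimpleGraph.Walk.take_length]; omega⟩,
    ⟨p.drop m, by rw [SimpleGraph.Walk.drop_length]; omega⟩⟩

theorem Near.map {n : ℕ} {x y : V} (f : G →g H) (h : Near G n x y) : Near H n (f x) (f y) := by
  obtain ⟨p, hp⟩ := h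
  exact ⟨p.map f, by simpa using hp⟩

theorem Near.of_mem_support {x y z : V} (p : G.Walk x y) (h : z ∈ p.support) :
    Near G p.length x z := by
  classical
  exact ⟨p.takeUntil z h, p.length_takeUntil_le_length h⟩

/-- A vertex close to the image of an embedding is the image of a close vertex, if the range of the
embedding contains the ball. -/
theorem Near.exists_preimage (f : G ↪g H) {n : ℕ} {a : V} {x : W} (h : Near H n (f a) x)
    (hf : ∀ y, Near H n (f a) y → y ∈ Set.range f) : ∃ b, f b = x ∧ Near G n a b := by
  induction n generalizing x with
  | zero =>
    obtain ⟨p, hp⟩ := h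
    exact ⟨a, p.eq_of_length_eq_zero (by omega), Near.refl _ _⟩
  | succ n ih =>
    obtain ⟨y, hy, hyx⟩ := h.split
    obtain ⟨b, rfl, hb⟩ := ih hy fun y hy => hf y (hy.mono (by omega))
    obtain ⟨c, rfl⟩ := hf x h
    refine ⟨c, rfl, ?_⟩
    rcases near_one_iff.1 hyx with h | h
    · rw [← f.injective h]
      exact hb.mono (by omega)
    · exact hb.trans (f.map_adj_iff.1 h).near le_rfl

theorem Near.mem_of_closed {s : Set V} (hs : ∀ x ∈ s, ∀ y, G.Adj x y → y ∈ s) {n : ℕ} {x y : V}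
    (h : Near G n x y) (hx : x ∈ s) : y ∈ s := by
  obtain ⟨p, -⟩ := h
  induction p with
  | nil => exact hx
  | cons h p ih => exact ih (hs _ hx _ h)

end Near

/-! ### The Ehrenfeucht–Fraïssé game and its local variant -/

section Game
variable {V W A B : Type*}

/-- The pairs of the relation `P` form a partial isomorphism. -/
def PartialIso (G : SimpleGraph V) (H : SimpleGraph W) (P : Set (V × W)) : Prop :=
  ∀ p ∈ P, ∀ q ∈ P, (p.1 = q.1 ↔ p.2 = q.2) ∧ (G.Adj p.1 q.1 ↔ H.Adj p.2 q.2)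

/-- Duplicator wins the Ehrenfeucht–Fraïssé game of `n` rounds from the position `P`. -/
def EF (G : SimpleGraph V) (H : SimpleGraph W) : ℕ → Set (V × W) → Prop
  | 0, P => PartialIso G H P
  | n + 1, P => PartialIso G H P ∧ (∀ v, ∃ w, EF G H n (insert (v, w) P)) ∧
      ∀ w, ∃ v, EF G H n (insert (v, w) P)

/-- Duplicator wins the local game of `n` rounds from the position `P`: with `i` rounds to go after
the present one, both players have to move within distance `2 ^ i` of an earlier vertex. -/
def LocalEF (G : SimpleGraph V) (H : SimpleGraph W) : ℕ → Set (V × W) → Prop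
  | 0, P => PartialIso G H P
  | n + 1, P => PartialIso G H P ∧
      (∀ p ∈ P, ∀ v, Near G (2 ^ n) p.1 v →
        ∃ w, (∃ q ∈ P, Near H (2 ^ n) q.2 w) ∧ LocalEF G H n (insert (v, w) P)) ∧
      ∀ p ∈ P, ∀ w, Near H (2 ^ n) p.2 w →
        ∃ v, (∃ q ∈ P, Near G (2 ^ n) q.1 v) ∧ LocalEF G H n (insert (v, w) P)

variable {G : SimpleGraph V} {H : SimpleGraph W} {K : SimpleGraph A} {L : SimpleGraph B}

theorem PartialIso.mono {P Q : Set (V × W)} (h : PartialIso G H Q) (hPQ : P ⊆ Q) :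
    PartialIso G H P :=
  fun p hp q hq => h p (hPQ hp) q (hPQ hq)

theorem PartialIso.swap {P : Set (V × W)} (h : PartialIso G H P) :
    PartialIso H G (Prod.swap ⁻¹' P) :=
  fun _ hp _ hq => ⟨(h _ hp _ hq).1.symm, (h _ hp _ hq).2.symm⟩

theorem swap_preimage_insert (v : V) (w : W) (P : Set (V × W)) :
    Prod.swap ⁻¹' insert (v, w) P = insert (w, v) (Prod.swap ⁻¹' P) := by
  ext ⟨a, b⟩
  simp [and_comm]

theorem EF.partialIso {n : ℕ} {P : Set (V × W)} (h : EF G H n P) : PartialIso G H P := by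
  cases n with
  | zero => exact h
  | succ n => exact h.1

theorem EF.mono {n : ℕ} {P Q : Set (V × W)} (h : EF G H n Q) (hPQ : P ⊆ Q) : EF G H n P := by
  induction n generalizing P Q with
  | zero => exact PartialIso.mono h hPQ
  | succ n ih =>
    refine ⟨h.1.mono hPQ, fun v => ?_, fun w => ?_⟩
    · obtain ⟨w, hw⟩ := h.2.1 v
      exact ⟨w, ih hw (Set.insert_subset_insert hPQ)⟩
    · obtain ⟨v, hv⟩ := h.2.2 w
      exact ⟨v, ih hv (Set.insert_subset_insert hPQ)⟩

theorem EF.of_succ {n : ℕ} {P : Set (V × W)} (h : EF G H (n + 1) P) : EF G H n P := by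
  induction n generalizing P with
  | zero => exact h.1
  | succ n ih =>
    refine ⟨h.1, fun v => ?_, fun w => ?_⟩
    · obtain ⟨w, hw⟩ := h.2.1 v
      exact ⟨w, ih hw⟩
    · obtain ⟨v, hv⟩ := h.2.2 w
      exact ⟨v, ih hv⟩

theorem EF.of_le {m n : ℕ} {P : Set (V × W)} (h : EF G H n P) (hmn : m ≤ n) : EF G H m P := by
  induction n, hmn using Nat.le_induction with
  | base => exact h
  | succ n _ ih => exact ih h.of_succ

theorem EF.swap {n : ℕ} {P : Set (V × W)} (h : EF G H n P) : EF H G n (Prod.swap ⁻¹' P) := by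
  induction n generalizing P with
  | zero => exact PartialIso.swap h
  | succ n ih =>
    refine ⟨h.1.swap, fun v => ?_, fun w => ?_⟩
    · obtain ⟨w, hw⟩ := h.2.2 v
      exact ⟨w, swap_preimage_insert w v P ▸ ih hw⟩
    · obtain ⟨v, hv⟩ := h.2.1 w
      exact ⟨v, swap_preimage_insert w v P ▸ ih hv⟩

/-- An isomorphism is a winning strategy. -/
theorem EF.of_iso (e : G ≃g H) (n : ℕ) {P : Set (V × W)} (hP : ∀ p ∈ P, p.2 = e p.1) :
    EF G H n P := by
  have hiso : PartialIso G H P := by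
    intro p hp q hq
    rw [hP p hp, hP q hq]
    exact ⟨e.injective.eq_iff.symm, e.map_adj_iff.symm⟩
  induction n generalizing P with
  | zero => exact hiso
  | succ n ih =>
    have hins : ∀ v, EF G H n (insert (v, e v) P) := fun v => by
      have h : ∀ p ∈ insert (v, e v) P, p.2 = e p.1 := by
        rintro p (rfl | hp)
        · rfl
        · exact hP p hp
      refine ih h fun p hp q hq => ?_
      rw [h p hp, h q hq]
      exact ⟨e.injective.eq_iff.symm, e.map_adj_iff.symm⟩
    exact ⟨hiso, fun v => ⟨e v, hins v⟩, fun w => ⟨e.symm w, by simpa using hins (e.symm w)⟩⟩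

/-- Each round halves a distance: Spoiler plays a midpoint of a short walk, and both halves are
preserved with one round less. -/
theorem EF.near {n : ℕ} {P : Set (V × W)} (h : EF G H n P) {p q : V × W} (hp : p ∈ P) (hq : q ∈ P)
    (hpq : Near G (2 ^ n) p.1 q.1) : Near H (2 ^ n) p.2 q.2 := by
  induction n generalizing P p q with
  | zero =>
    have := h.partialIso p hp q hq
    rw [pow_zero, near_one_iff] at hpq ⊢
    rwa [← this.1, ← this.2]
  | succ n ih =>
    rw [pow_succ, mul_two] at hpq ⊢
    obtain ⟨z, hz, hz'⟩ := hpq.split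
    obtain ⟨w, hw⟩ := h.2.1 z
    exact (ih hw (q := (z, w)) (.inr hp) (.inl rfl) hz).trans
      (ih hw (p := (z, w)) (.inl rfl) (.inr hq) hz') le_rfl

theorem LocalEF.partialIso {n : ℕ} {P : Set (V × W)} (h : LocalEF G H n P) :
    PartialIso G H P := by
  cases n with
  | zero => exact h
  | succ n => exact h.1

/-- The halving argument survives in the local game, since the midpoint is within the permitted
distance of an earlier vertex. -/
theorem LocalEF.near {n : ℕ} {P : Set (V × W)} (h : LocalEF G H n P) {p q : V × W} (hp : p ∈ P)
    (hq : q ∈ P) (hpq : Near G (2 ^ n) p.1 q.1) : Near H (2 ^ n) p.2 q.2 := by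
  induction n generalizing P p q with
  | zero =>
    have := h.partialIso p hp q hq
    rw [pow_zero, near_one_iff] at hpq ⊢
    rwa [← this.1, ← this.2]
  | succ n ih =>
    rw [pow_succ, mul_two] at hpq ⊢
    obtain ⟨z, hz, hz'⟩ := hpq.split
    obtain ⟨w, -, hw⟩ := h.2.1 p hp z hz
    exact (ih hw (q := (z, w)) (.inr hp) (.inl rfl) hz).trans
      (ih hw (p := (z, w)) (.inl rfl) (.inr hq) hz') le_rfl

theorem LocalEF.swap {n : ℕ} {P : Set (V × W)} (h : LocalEF G H n P) :
    LocalEF H G n (Prod.swap ⁻¹' P) := by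
  induction n generalizing P with
  | zero => exact PartialIso.swap h
  | succ n ih =>
    refine ⟨h.1.swap, fun p hp v hv => ?_, fun p hp w hw => ?_⟩
    · obtain ⟨w, ⟨q, hq, hqw⟩, hw⟩ := h.2.2 p.swap hp v hv
      exact ⟨w, ⟨q.swap, by simpa using hq, hqw⟩, swap_preimage_insert w v P ▸ ih hw⟩
    · obtain ⟨v, ⟨q, hq, hqv⟩, hv⟩ := h.2.1 p.swap hp w hw
      exact ⟨v, ⟨q.swap, by simpa using hq, hqv⟩, swap_preimage_insert w v P ▸ ih hv⟩

/-- Dropping a round also shrinks the distance permitted for answers. The old answer is still legal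
because the position it leads to preserves short distances (`LocalEF.near`). -/
theorem LocalEF.of_succ {n : ℕ} {P : Set (V × W)} (h : LocalEF G H (n + 1) P) :
    LocalEF G H n P := by
  induction n generalizing P with
  | zero => exact h.1
  | succ n ih =>
    have hle : 2 ^ n ≤ 2 ^ (n + 1) := Nat.pow_le_pow_right (by norm_num) (by omega)
    refine ⟨h.1, fun p hp v hv => ?_, fun p hp w hw => ?_⟩
    · obtain ⟨w, -, hw⟩ := h.2.1 p hp v (hv.mono hle)
      exact ⟨w, ⟨p, hp, (ih hw).near (q := (v, w)) (.inr hp) (.inl rfl) hv⟩, ih hw⟩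
    · obtain ⟨v, -, hv⟩ := h.2.2 p hp w (hw.mono hle)
      exact ⟨v, ⟨p, hp, (ih hv).swap.near (p := p.swap) (q := (w, v)) (.inr hp) (.inl rfl) hw⟩,
        ih hv⟩

/-- Games on pieces embedded together with large balls around the chosen vertices are local games on
the whole graphs. -/
theorem EF.localEF (f : K ↪g G) (g : L ↪g H) {n : ℕ} {P : Set (A × B)} (h : EF K L n P)
    (hf : ∀ p ∈ P, ∀ x, Near G (2 ^ n - 1) (f p.1) x → x ∈ Set.range f)
    (hg : ∀ p ∈ P, ∀ x, Near H (2 ^ n - 1) (g p.2) x → x ∈ Set.range g) :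
    LocalEF G H n (Prod.map f g '' P) := by
  have hiso : PartialIso G H (Prod.map f g '' P) := by
    rintro _ ⟨p, hp, rfl⟩ _ ⟨q, hq, rfl⟩
    have := h.partialIso p hp q hq
    simpa [f.injective.eq_iff, g.injective.eq_iff] using this
  induction n generalizing P with
  | zero => exact hiso
  | succ n ih =>
    have h1 : 1 ≤ 2 ^ n := Nat.one_le_two_pow
    have h2 : 2 ^ (n + 1) = 2 ^ n + 2 ^ n := by rw [pow_succ, mul_two]
    have key : ∀ p ∈ P, ∀ q : A × B, Near K (2 ^ n) p.1 q.1 → Near L (2 ^ n) p.2 q.2 →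
        EF K L n (insert q P) → LocalEF G H n (insert (f q.1, g q.2) (Prod.map f g '' P)) := by
      intro p hp q hpq hpq' hq
      have himg : insert (f q.1, g q.2) (Prod.map f g '' P) = Prod.map f g '' insert q P := by
        rw [Set.image_insert_eq]
        rfl
      rw [himg]
      refine ih hq ?_ ?_ ?_
      · rintro s (rfl | hs) x hx
        -- The new vertex is at distance at most `2 ^ n`, and `2 ^ n + (2 ^ n - 1) = 2 ^ (n + 1) -
        -- 1` is the radius available around the old one.
        · exact hf p hp x ((hpq.map f.toHom).trans hx (by omega))
        · exact hf s hs x (hx.mono (by omega))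
      · rintro s (rfl | hs) x hx
        · exact hg p hp x ((hpq'.map g.toHom).trans hx (by omega))
        · exact hg s hs x (hx.mono (by omega))
      · rintro _ ⟨p, hp, rfl⟩ _ ⟨q, hq', rfl⟩
        have := hq.partialIso p hp q hq'
        simpa [f.injective.eq_iff, g.injective.eq_iff] using this
    refine ⟨hiso, ?_, ?_⟩
    · rintro _ ⟨p, hp, rfl⟩ v hv
      obtain ⟨c, rfl, hc⟩ := Near.exists_preimage f hv
        fun y hy => hf p hp y (Near.mono hy (by omega))
      obtain ⟨d, hd⟩ := h.2.1 c
      have hpd := hd.near (q := (c, d)) (.inr hp) (.inl rfl) hc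
      exact ⟨g d, ⟨_, ⟨p, hp, rfl⟩, hpd.map g.toHom⟩, key p hp (c, d) hc hpd hd⟩
    · rintro _ ⟨p, hp, rfl⟩ v hv
      obtain ⟨d, rfl, hd⟩ := Near.exists_preimage g hv
        fun y hy => hg p hp y (Near.mono hy (by omega))
      obtain ⟨c, hc⟩ := h.2.2 d
      have hpc : Near K (2 ^ n) p.1 c :=
        hc.swap.near (p := p.swap) (q := (d, c)) (.inr hp) (.inl rfl) hd
      exact ⟨f c, ⟨_, ⟨p, hp, rfl⟩, hpc.map f.toHom⟩, key p hp (c, d) hpc hd hc⟩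

/-- Vertices from different groups are neither equal nor adjacent, on either side. -/
theorem PartialIso.iUnion {ι : Type*} {n : ℕ} {P : ι → Set (V × W)}
    (h : ∀ a, PartialIso G H (P a))
    (hG : ∀ a b, a ≠ b → ∀ p ∈ P a, ∀ q ∈ P b, ¬ Near G (2 ^ n) p.1 q.1)
    (hH : ∀ a b, a ≠ b → ∀ p ∈ P a, ∀ q ∈ P b, ¬ Near H (2 ^ n) p.2 q.2) :
    PartialIso G H (⋃ a, P a) := by
  intro p hp q hq
  obtain ⟨a, hp⟩ := Set.mem_iUnion.1 hp
  obtain ⟨b, hq⟩ := Set.mem_iUnion.1 hq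
  by_cases hab : a = b
  · subst hab
    exact h a p hp q hq
  · have hg := mt (fun h => (near_one_iff.2 h).mono Nat.one_le_two_pow) (hG a b hab p hp q hq)
    have hh := mt (fun h => (near_one_iff.2 h).mono Nat.one_le_two_pow) (hH a b hab p hp q hq)
    tauto

/-- Local games on groups of vertices that are far apart can be combined. -/
theorem LocalEF.iUnion {ι : Type*} {n : ℕ} {P : ι → Set (V × W)} (h : ∀ a, LocalEF G H n (P a))
    (hG : ∀ a b, a ≠ b → ∀ p ∈ P a, ∀ q ∈ P b, ¬ Near G (2 ^ n) p.1 q.1)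
    (hH : ∀ a b, a ≠ b → ∀ p ∈ P a, ∀ q ∈ P b, ¬ Near H (2 ^ n) p.2 q.2) :
    LocalEF G H n (⋃ a, P a) := by
  have hiso := PartialIso.iUnion (fun a => (h a).partialIso) hG hH
  induction n generalizing P with
  | zero => exact hiso
  | succ n ih =>
    have h1 : 1 ≤ 2 ^ n := Nat.one_le_two_pow
    have h2 : 2 ^ (n + 1) = 2 ^ n + 2 ^ n := by rw [pow_succ, mul_two]
    have key : ∀ a v w, (∃ p ∈ P a, Near G (2 ^ n) p.1 v) → (∃ p ∈ P a, Near H (2 ^ n) p.2 w) →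
        LocalEF G H n (insert (v, w) (P a)) → LocalEF G H n (insert (v, w) (⋃ a, P a)) := by
      intro a v w hv hw hvw
      -- Only the group `a` grows, so the index type is kept. The new vertices are within `2 ^ n` of
      -- that group, so a separation beyond `2 ^ (n + 1)` from the other groups leaves one beyond `2
      -- ^ n`.
      have hU : insert (v, w) (⋃ a, P a) = ⋃ b, (P b ∪ {q | b = a ∧ q = (v, w)}) := by
        ext q
        simp only [Set.mem_insert_iff, Set.mem_iUnion, Set.mem_union, Set.mem_ofPred_eq]
        constructor
        · rintro (rfl | ⟨b, hb⟩)
          · exact ⟨a, .inr ⟨rfl, rfl⟩⟩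
          · exact ⟨b, .inl hb⟩
        · rintro ⟨b, hb | ⟨-, rfl⟩⟩
          · exact .inr ⟨b, hb⟩
          · exact .inl rfl
      have hL : ∀ b, LocalEF G H n (P b ∪ {q | b = a ∧ q = (v, w)}) := by
        intro b
        by_cases hb : b = a
        · subst hb
          convert hvw using 1
          ext q
          simp [or_comm]
        · simpa [hb] using (h b).of_succ
      have hG' : ∀ b c, b ≠ c → ∀ p ∈ P b ∪ {q | b = a ∧ q = (v, w)},
          ∀ q ∈ P c ∪ {q | c = a ∧ q = (v, w)}, ¬ Near G (2 ^ n) p.1 q.1 := by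
        obtain ⟨s, hs, hsv⟩ := hv
        rintro b c hbc p (hp | ⟨rfl, rfl⟩) q (hq | ⟨rfl, rfl⟩) hpq
        · exact hG b c hbc p hp q hq (hpq.mono (by omega))
        · exact hG b c hbc p hp s hs (hpq.trans hsv.symm (by omega))
        · exact hG b c hbc s hs q hq (hsv.trans hpq (by omega))
        · exact hbc rfl
      have hH' : ∀ b c, b ≠ c → ∀ p ∈ P b ∪ {q | b = a ∧ q = (v, w)},
          ∀ q ∈ P c ∪ {q | c = a ∧ q = (v, w)}, ¬ Near H (2 ^ n) p.2 q.2 := by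
        obtain ⟨s, hs, hsv⟩ := hw
        rintro b c hbc p (hp | ⟨rfl, rfl⟩) q (hq | ⟨rfl, rfl⟩) hpq
        · exact hH b c hbc p hp q hq (hpq.mono (by omega))
        · exact hH b c hbc p hp s hs (hpq.trans hsv.symm (by omega))
        · exact hH b c hbc s hs q hq (hsv.trans hpq (by omega))
        · exact hbc rfl
      rw [hU]
      exact ih hL hG' hH' (PartialIso.iUnion (fun b => (hL b).partialIso) hG' hH')
    refine ⟨hiso, ?_, ?_⟩
    · intro p hp v hv
      obtain ⟨a, hp⟩ := Set.mem_iUnion.1 hp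
      obtain ⟨w, ⟨q, hq, hqw⟩, hw⟩ := (h a).2.1 p hp v hv
      exact ⟨w, ⟨q, Set.mem_iUnion.2 ⟨a, hq⟩, hqw⟩, key a v w ⟨p, hp, hv⟩ ⟨q, hq, hqw⟩ hw⟩
    · intro p hp w hw
      obtain ⟨a, hp⟩ := Set.mem_iUnion.1 hp
      obtain ⟨v, ⟨q, hq, hqv⟩, hv⟩ := (h a).2.2 p hp w hw
      exact ⟨v, ⟨q, Set.mem_iUnion.2 ⟨a, hq⟩, hqv⟩, key a v w ⟨q, hq, hqv⟩ ⟨p, hp, hw⟩ hv⟩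

end Game

/-! ### The game and first-order logic -/

section Logic
variable {V W α : Type*} {n : ℕ}

/-- The formula `φ` holds in the graph `G` under the given assignments. -/
def Holds (G : SimpleGraph V) (φ : Language.graph.BoundedFormula α n) (v : α → V)
    (xs : Fin n → V) : Prop :=
  letI := G.structure
  φ.Realize v xs

variable {G : SimpleGraph V} {H : SimpleGraph W}

theorem holds_not {φ : Language.graph.BoundedFormula α n} {v : α → V} {xs : Fin n → V} :
    Holds G φ.not v xs ↔ ¬ Holds G φ v xs :=
  Iff.rfl

theorem holds_imp {φ ψ : Language.graph.BoundedFormula α n} {v : α → V} {xs : Fin n → V} :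
    Holds G (φ.imp ψ) v xs ↔ (Holds G φ v xs → Holds G ψ v xs) :=
  Iff.rfl

theorem holds_all {φ : Language.graph.BoundedFormula α (n + 1)} {v : α → V} {xs : Fin n → V} :
    Holds G φ.all v xs ↔ ∀ x, Holds G φ v (Fin.snoc xs x) :=
  Iff.rfl

theorem holds_ex {φ : Language.graph.BoundedFormula α (n + 1)} {v : α → V} {xs : Fin n → V} :
    Holds G φ.ex v xs ↔ ∃ x, Holds G φ v (Fin.snoc xs x) := by
  let := G.structure
  exact Language.BoundedFormula.realize_ex

theorem holds_iInf {β : Type*} [Finite β] {φ : β → Language.graph.BoundedFormula α n} {v : α → V}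
    {xs : Fin n → V} :
    Holds G (Language.BoundedFormula.iInf φ) v xs ↔ ∀ b, Holds G (φ b) v xs := by
  let := G.structure
  exact Language.BoundedFormula.realize_iInf

theorem quantifierRank_not (φ : Language.graph.BoundedFormula α n) :
    quantifierRank φ.not = quantifierRank φ :=
  Nat.max_zero _

theorem quantifierRank_ex (φ : Language.graph.BoundedFormula α (n + 1)) :
    quantifierRank φ.ex = quantifierRank φ + 1 :=
  (quantifierRank_not _).trans (congrArg (· + 1) (quantifierRank_not φ))

theorem quantifierRank_iInf_le {β : Type*} [Finite β] {φ : β → Language.graph.BoundedFormula α n}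
    {k : ℕ} (h : ∀ b, quantifierRank (φ b) ≤ k) :
    quantifierRank (Language.BoundedFormula.iInf φ) ≤ k := by
  have key : ∀ l : List (Language.graph.BoundedFormula α n), (∀ ψ ∈ l, quantifierRank ψ ≤ k) →
      quantifierRank (l.foldr (· ⊓ ·) ⊤) ≤ k := by
    intro l hl
    induction l with
    | nil => exact Nat.zero_le _
    | cons ψ l ih =>
      refine (quantifierRank_not _).trans_le (max_le (hl ψ (by simp)) ?_)
      exact (quantifierRank_not _).trans_le (ih fun χ hχ => hl χ (by simp [hχ]))
  refine key _ fun ψ hψ => ?_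
  simp only [List.mem_map] at hψ
  obtain ⟨b, -, rfl⟩ := hψ
  exact h b

/-- The values of corresponding variables, as a position of the game. -/
def varPairs (v : α → V) (v' : α → W) (xs : Fin n → V) (xs' : Fin n → W) : Set (V × W) :=
  Set.range fun i : α ⊕ Fin n => (Sum.elim v xs i, Sum.elim v' xs' i)

theorem varPairs_snoc (v : α → V) (v' : α → W) (xs : Fin n → V) (xs' : Fin n → W) (x : V)
    (y : W) : varPairs v v' (Fin.snoc xs x : Fin (n + 1) → V) (Fin.snoc xs' y : Fin (n + 1) → W) =
      insert (x, y) (varPairs v v' xs xs') := by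
  ext p
  simp only [varPairs, Set.mem_range, Set.mem_insert_iff, Sum.exists, Sum.elim_inl, Sum.elim_inr]
  constructor
  · rintro (⟨a, rfl⟩ | ⟨i, rfl⟩)
    · exact .inr (.inl ⟨a, rfl⟩)
    · refine Fin.lastCases (.inl (by simp)) (fun j => .inr (.inr ⟨j, by simp⟩)) i
  · rintro (rfl | ⟨a, rfl⟩ | ⟨j, rfl⟩)
    · exact .inr ⟨Fin.last n, by simp⟩
    · exact .inl ⟨a, rfl⟩
    · exact .inr ⟨j.castSucc, by simp⟩

theorem EF.holds_iff {k : ℕ} {φ : Language.graph.BoundedFormula α n} {v : α → V} {v' : α → W}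
    {xs : Fin n → V} {xs' : Fin n → W} (h : EF G H k (varPairs v v' xs xs'))
    (hφ : quantifierRank φ ≤ k) : Holds G φ v xs ↔ Holds H φ v' xs' := by
  induction φ generalizing k with
  | falsum => exact Iff.rfl
  | equal t₁ t₂ =>
    match t₁, t₂ with
    | .var a, .var b => exact (h.partialIso _ ⟨a, rfl⟩ _ ⟨b, rfl⟩).1
  | @rel n l R ts =>
    match l, R with
    | _, .adj =>
      -- The language has no function symbols, so every term is a variable.
      have h0 : ∃ a, ts 0 = .var a := match ts 0 with | .var a => ⟨a, rfl⟩
      have h1 : ∃ a, ts 1 = .var a := match ts 1 with | .var a => ⟨a, rfl⟩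
      obtain ⟨a, ha⟩ := h0
      obtain ⟨b, hb⟩ := h1
      have hab := (h.partialIso _ ⟨a, rfl⟩ _ ⟨b, rfl⟩).2
      let := G.structure
      let := H.structure
      change G.Adj ((ts 0).realize _) ((ts 1).realize _) ↔
        H.Adj ((ts 0).realize _) ((ts 1).realize _)
      rw [ha, hb]
      exact hab
  | imp φ ψ ih₁ ih₂ =>
    rw [holds_imp, holds_imp, ih₁ h ((le_max_left _ _).trans hφ),
      ih₂ h ((le_max_right _ _).trans hφ)]
  | all φ ih =>
    obtain ⟨k, rfl⟩ : ∃ j, k = j + 1 := Nat.exists_eq_succ_of_ne_zero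
      fun hk => by subst hk; exact Nat.not_succ_le_zero _ hφ
    rw [holds_all, holds_all]
    have hφ' : quantifierRank φ ≤ k := Nat.le_of_succ_le_succ hφ
    constructor
    · intro hx y
      obtain ⟨x, hxy⟩ := h.2.2 y
      rw [← varPairs_snoc] at hxy
      exact (ih hxy hφ').1 (hx x)
    · intro hy x
      obtain ⟨y, hxy⟩ := h.2.1 x
      rw [← varPairs_snoc] at hxy
      exact (ih hxy hφ').2 (hy y)

theorem EF.elemEquiv {k : ℕ} (h : EF G H k ∅) : ElemEquiv k G H := by
  intro φ hφ
  refine EF.holds_iff (h.mono ?_) hφ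
  rintro _ ⟨i | i, -⟩
  · exact i.elim
  · exact i.elim0

/-- Finitely many formulas of quantifier rank at most `k` decide the game of `k` rounds. -/
theorem exists_finite_formulas (α : Type) [Finite α] (k n : ℕ) :
    ∃ (ι : Type) (_ : Finite ι) (Φ : ι → Language.graph.BoundedFormula α n),
      (∀ i, quantifierRank (Φ i) ≤ k) ∧
      ∀ (V W : Type u) (G : SimpleGraph V) (H : SimpleGraph W) (v : α → V) (v' : α → W)
        (xs : Fin n → V) (xs' : Fin n → W), (∀ i, Holds G (Φ i) v xs ↔ Holds H (Φ i) v' xs') →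
        EF G H k (varPairs v v' xs xs') := by
  have atomic : ∀ n, ∃ (ι : Type) (_ : Finite ι) (Φ : ι → Language.graph.BoundedFormula α n),
      (∀ i, quantifierRank (Φ i) = 0) ∧
      ∀ (V W : Type u) (G : SimpleGraph V) (H : SimpleGraph W) (v : α → V) (v' : α → W)
        (xs : Fin n → V) (xs' : Fin n → W), (∀ i, Holds G (Φ i) v xs ↔ Holds H (Φ i) v' xs') →
        PartialIso G H (varPairs v v' xs xs') := by
    intro n
    refine ⟨((α ⊕ Fin n) × (α ⊕ Fin n)) ⊕ ((α ⊕ Fin n) × (α ⊕ Fin n)), inferInstance,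
      Sum.elim (fun p => .equal (.var p.1) (.var p.2))
        (fun p => .rel Language.adj ![.var p.1, .var p.2]), ?_, ?_⟩
    · rintro (i | i) <;> rfl
    · rintro V W G H v v' xs xs' h _ ⟨a, rfl⟩ _ ⟨b, rfl⟩
      exact ⟨h (.inl (a, b)), h (.inr (a, b))⟩
  induction k generalizing n with
  | zero =>
    obtain ⟨ι, hι, Φ, hΦ, h⟩ := atomic n
    exact ⟨ι, hι, Φ, fun i => (hΦ i).le, h⟩
  | succ k ih =>
    obtain ⟨ι₀, _, Φ₀, hΦ₀, h₀⟩ := atomic n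
    obtain ⟨ι, _, Φ, hΦ, h⟩ := ih (n + 1)
    classical
    -- `Ψ A` says that the formulas with index in `A`, and no others, hold of the extended tuple.
    -- Its existential closure says that some move leads to the type `A`; there are finitely many
    -- `A`.
    let Ψ (A : Set ι) : Language.graph.BoundedFormula α (n + 1) :=
      Language.BoundedFormula.iInf fun i => if i ∈ A then Φ i else (Φ i).not
    have hΨ : ∀ {V : Type u} (G : SimpleGraph V) (v : α → V) (xs : Fin (n + 1) → V) (A : Set ι),
        Holds G (Ψ A) v xs ↔ ∀ i, (Holds G (Φ i) v xs ↔ i ∈ A) := by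
      intro V G v xs A
      refine holds_iInf.trans (forall_congr' fun i => ?_)
      by_cases hi : i ∈ A <;> simp [hi, holds_not]
    refine ⟨ι₀ ⊕ Set ι, inferInstance, Sum.elim Φ₀ fun A => (Ψ A).ex, ?_, ?_⟩
    · rintro (i | A)
      · simp [hΦ₀]
      · refine (quantifierRank_ex _).trans_le (Nat.succ_le_succ (quantifierRank_iInf_le fun i => ?_))
        split_ifs
        · exact hΦ i
        · exact (quantifierRank_not _).trans_le (hΦ i)
    · intro V W G H v v' xs xs' hφ
      refine ⟨h₀ V W G H v v' xs xs' fun i => hφ (.inl i), fun x => ?_, fun y => ?_⟩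
      · have hx : Holds G (Ψ {i | Holds G (Φ i) v (Fin.snoc xs x)}).ex v xs :=
          holds_ex.2 ⟨x, (hΨ _ _ _ _).2 fun i => Iff.rfl⟩
        obtain ⟨y, hy⟩ := holds_ex.1 ((hφ (.inr _)).1 hx)
        refine ⟨y, ?_⟩
        rw [← varPairs_snoc]
        exact h V W G H v v' _ _ fun i => ((hΨ _ _ _ _).1 hy i).symm
      · have hy : Holds H (Ψ {i | Holds H (Φ i) v' (Fin.snoc xs' y)}).ex v' xs' :=
          holds_ex.2 ⟨y, (hΨ _ _ _ _).2 fun i => Iff.rfl⟩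
        obtain ⟨x, hx⟩ := holds_ex.1 ((hφ (.inr _)).2 hy)
        refine ⟨x, ?_⟩
        rw [← varPairs_snoc]
        exact h V W G H v v' _ _ fun i => (hΨ _ _ _ _).1 hx i

/-- Logical classes are given by sentences, whereas pieces are compared by games; this passes from
the former to the latter. -/
theorem EF.of_logicalType_eq {k : ℕ} {V W : Type u} {G : SimpleGraph V} {H : SimpleGraph W}
    (h : logicalType k G = logicalType k H) : EF G H k ∅ := by
  obtain ⟨ι, _, Φ, hΦ, hEF⟩ := exists_finite_formulas.{u} Empty k 0
  refine (hEF V W G H default default default default fun i => ?_).mono (Set.empty_subset _)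
  have := Set.ext_iff.1 h (Φ i)
  exact (and_iff_right (hΦ i)).symm.trans (this.trans (and_iff_right (hΦ i)))

theorem EF.of_rootedLogicalType_eq {k : ℕ} {V W : Type u} {G : SimpleGraph V} {H : SimpleGraph W}
    {x : V} {y : W} (h : rootedLogicalType k G x = rootedLogicalType k H y) :
    EF G H k {(x, y)} := by
  obtain ⟨ι, _, Φ, hΦ, hEF⟩ := exists_finite_formulas.{u} Unit k 0
  refine (hEF V W G H (fun _ => x) (fun _ => y) default default fun i => ?_).mono ?_
  · have := Set.ext_iff.1 h (Φ i)
    exact (and_iff_right (hΦ i)).symm.trans (this.trans (and_iff_right (hΦ i)))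
  · rintro _ rfl
    exact ⟨.inl (), rfl⟩

end Logic

/-! ### Short cycles in balls -/

section Cycles
variable {V W : Type*} {G : SimpleGraph V} {H : SimpleGraph W}

/-- Distance to `v` decreases along a geodesic. This keeps chosen edges off geodesics when cycles
are closed up below. -/
theorem exists_geodesic {x v : V} (h : G.Reachable x v) :
    ∃ q : G.Walk x v, q.length = G.dist x v ∧ ∀ z ∈ q.support, z = x ∨ G.dist z v < G.dist x v := by
  classical
  obtain ⟨q, hq⟩ := h.exists_walk_length_eq_dist
  refine ⟨q, hq, fun z hz => ?_⟩
  by_cases hzx : z = x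
  · exact .inl hzx
  · right
    have h1 := congrArg SimpleGraph.Walk.length (q.take_spec hz)
    rw [SimpleGraph.Walk.length_append] at h1
    have h2 : 0 < (q.takeUntil z hz).length := by
      rw [Nat.pos_iff_ne_zero]
      exact fun h0 => hzx (SimpleGraph.Walk.eq_of_length_eq_zero h0).symm
    have h3 := SimpleGraph.dist_le (q.dropUntil z hz)
    omega

/-- Shortening the walk to a path adds no edge, so the path still avoids the edge that closes it. -/
theorem exists_isCycle_of_walk {x y : V} (h : G.Adj x y) (p : G.Walk y x) (hp : s(x, y) ∉ p.edges) :
    ∃ c : G.Walk x x, c.IsCycle ∧ c.length ≤ p.length + 1 := by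
  classical
  refine ⟨.cons h p.bypass, SimpleGraph.Path.cons_isCycle ⟨p.bypass, p.bypass_isPath⟩ h
    fun he => hp (p.edges_bypass_subset_edges he), ?_⟩
  have := p.length_bypass_le_length
  simpa using this

/-- If some cycle runs within distance `m` of `v`, then some cycle of length at most `2 * m + 1`
meets the `m`-neighborhood of `v`. -/
theorem exists_short_cycle {v u : V} {m : ℕ} {c : G.Walk u u} (hc : c.IsCycle)
    (hm : ∀ x ∈ c.support, Near G m x v) :
    ∃ (y : V) (c' : G.Walk y y), c'.IsCycle ∧ c'.length ≤ 2 * m + 1 ∧ Near G m y v := by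
  classical
  -- `y` is a vertex of the cycle farthest from `v`. Its two neighbors on the cycle are no farther,
  -- and geodesics from there to `v` produce the short cycle.
  obtain ⟨y, hy, hmax⟩ := c.support.toFinset.exists_max_image (fun x => G.dist x v)
    ⟨u, by simp⟩
  rw [List.mem_toFinset] at hy
  have hdist : ∀ x ∈ c.support, G.dist x v ≤ m := fun x hx => by
    obtain ⟨p, hp⟩ := hm x hx
    exact (SimpleGraph.dist_le p).trans hp
  have hmax' : ∀ x ∈ c.support, G.dist x v ≤ G.dist y v :=
    fun x hx => hmax x (List.mem_toFinset.2 hx)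
  have hgeo : ∀ x ∈ c.support, ∃ q : G.Walk x v, q.length = G.dist x v ∧
      ∀ z ∈ q.support, z = x ∨ G.dist z v < G.dist x v := fun x hx => by
    obtain ⟨p, -⟩ := hm x hx
    exact exists_geodesic p.reachable
  have hd := hc.rotate hy
  set d := c.rotate y hy with hd_def
  have hmem : ∀ x ∈ d.support, x ∈ c.support := fun x hx =>
    (SimpleGraph.Walk.mem_support_rotate_iff ..).1 hx
  have hnil := hd.not_nil
  have hya := d.adj_snd hnil
  have hby := d.adj_penultimate hnil
  have hab := hd.snd_ne_penultimate
  have ha : d.snd ∈ c.support := hmem _ (d.getVert_mem_support 1)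
  have hb : d.penultimate ∈ c.support := hmem _ (d.getVert_mem_support _)
  generalize d.snd = a at hya hab ha
  generalize d.penultimate = b at hby hab hb
  obtain ⟨qy, hqy, hqy'⟩ := hgeo y hy
  -- If `x` and `y` are equally far from `v`, neither lies on the geodesic of the other, so the edge
  -- joining them closes the two geodesics to a cycle of length at most `2 * m + 1`.
  have level : ∀ x ∈ c.support, G.Adj x y → G.dist x v = G.dist y v →
      ∃ (y : V) (c' : G.Walk y y), c'.IsCycle ∧ c'.length ≤ 2 * m + 1 ∧ Near G m y v := by
    intro x hx hxy hdxy
    obtain ⟨qx, hqx, hqx'⟩ := hgeo x hx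
    obtain ⟨c', hc', hl⟩ := exists_isCycle_of_walk hxy (qy.append qx.reverse) (by
      rw [SimpleGraph.Walk.edges_append, SimpleGraph.Walk.edges_reverse, List.mem_append,
        List.mem_reverse]
      rintro (h | h)
      · rcases hqy' x (qy.fst_mem_support_of_mem_edges h) with h | h
        · exact hxy.ne h
        · omega
      · rcases hqx' y (qx.snd_mem_support_of_mem_edges h) with h | h
        · exact hxy.ne h.symm
        · omega)
    have := hdist x hx
    have := hdist y hy
    rw [SimpleGraph.Walk.length_append, SimpleGraph.Walk.length_reverse] at hl
    exact ⟨x, c', hc', by omega, hm x hx⟩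
  rcases (hmax' a ha).eq_or_lt with hda | hda
  · exact level a ha hya.symm hda
  rcases (hmax' b hb).eq_or_lt with hdb | hdb
  · exact level b hb hby hdb
  -- Both neighbors are now strictly closer than `y`, so their geodesics miss `y`. The two edges at
  -- `y` differ, and the closed walk has length at most `2 + 2 * (G.dist y v - 1)`.
  obtain ⟨qa, hqa, hqa'⟩ := hgeo a ha
  obtain ⟨qb, hqb, hqb'⟩ := hgeo b hb
  obtain ⟨c', hc', hl⟩ := exists_isCycle_of_walk hby (.cons hya (qa.append qb.reverse)) (by
    rw [SimpleGraph.Walk.edges_cons, SimpleGraph.Walk.edges_append,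
      SimpleGraph.Walk.edges_reverse, List.mem_cons, List.mem_append, List.mem_reverse]
    rintro (h | h | h)
    · rw [Sym2.eq_swap, Sym2.congr_right] at h
      exact hab h.symm
    · rcases hqa' y (qa.snd_mem_support_of_mem_edges h) with h | h
      · exact hya.ne h
      · omega
    · rcases hqb' y (qb.snd_mem_support_of_mem_edges h) with h | h
      · exact hby.ne h.symm
      · omega)
  have := hdist y hy
  rw [SimpleGraph.Walk.length_cons, SimpleGraph.Walk.length_append,
    SimpleGraph.Walk.length_reverse] at hl
  exact ⟨b, c', hc', by omega, hm b hb⟩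

theorem exists_isCycle_preimage (f : G ↪g H) {x : W} {c : H.Walk x x} (hc : c.IsCycle)
    (hf : ∀ z ∈ c.support, z ∈ Set.range f) :
    ∃ (b : V) (c' : G.Walk b b), f b = x ∧ c'.IsCycle ∧ c'.length = c.length := by
  obtain ⟨b, hb⟩ : ∃ b, f.isoInduceRange b = ⟨x, hf x c.start_mem_support⟩ :=
    f.isoInduceRange.surjective _
  have h1 : (c.induce (Set.range f) hf).IsCycle := by
    refine SimpleGraph.Walk.IsCycle.of_map (f := (SimpleGraph.Embedding.induce _).toHom) ?_
    rwa [SimpleGraph.Walk.map_induce]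
  have h2 := (SimpleGraph.Walk.isCycle_map_iff_of_injective
    (f := f.isoInduceRange.symm.toHom) f.isoInduceRange.symm.injective).2 h1
  refine ⟨_, _, ?_, h2, ?_⟩
  · change f (f.isoInduceRange.symm ⟨x, _⟩) = x
    rw [← hb, RelIso.symm_apply_apply]
    exact congrArg Subtype.val hb
  · rw [SimpleGraph.Walk.length_map]
    exact (SimpleGraph.Walk.length_map _ _).symm.trans
      (congrArg SimpleGraph.Walk.length (c.map_induce hf))

end Cycles

/-! ### Graphs that are locally trees away from a core -/

section TreeRich
variable {V W : Type u} {G : SimpleGraph V} {H : SimpleGraph W} {C : Set V} {D : Set W} {k : ℕ}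

/-- Away from the core `C`, the graph is locally a tree; every tree of small depth is equivalent to
many components that avoid the core. -/
structure TreeRich (k : ℕ) (G : SimpleGraph V) (C : Set V) : Prop where
  isTree_ball : ∀ i < k, ∀ v, (∀ c ∈ C, ¬ Near G (2 ^ i) c v) →
    (G.induce (ball G (2 ^ i - 1) v)).IsTree
  exists_component : ∀ (A : Type u) (T : SimpleGraph A) (t : A), T.IsTree →
    (∀ a, Near T (2 ^ (k - 1)) t a) → ∀ F : Finset V, F.card < k →
    ∃ (B : Type u) (K : SimpleGraph B) (f : K ↪g G) (b : B), EF T K k {(t, b)} ∧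
      (∀ x ∈ Set.range f, ∀ y, G.Adj x y → y ∈ Set.range f) ∧
      ∀ x ∈ Set.range f, x ∉ C ∧ x ∉ F

theorem near_of_mem_ball {n : ℕ} {v w : V} (h : w ∈ ball G n v) : Near G n v w :=
  edist_le_iff_near.1 h

theorem near_induce_ball {n : ℕ} {v : V} (w : ball G n v) :
    Near (G.induce (ball G n v)) n (ballRoot G n v) w := by
  obtain ⟨b, hb, h⟩ := Near.exists_preimage (SimpleGraph.Embedding.induce (ball G n v))
    (a := ballRoot G n v) (near_of_mem_ball w.2) fun y hy => ⟨⟨y, edist_le_iff_near.2 hy⟩, rfl⟩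
  rwa [← Subtype.ext hb]

/-- The position covers the core `C`, so `v` is far from the core and its ball of radius `2 ^ i - 1`
is a tree; that radius is all a local game of `i` rounds can see. The answer is a vertex of an
equivalent component that contains no earlier vertex, hence at infinite distance from all of them.
-/
theorem TreeRich.exists_response (hG : TreeRich k G C) (hH : TreeRich k H D) {i : ℕ} (hi : i < k)
    {P : Set (V × W)} (hP : LocalEF G H i P) (hC : ∀ c ∈ C, ∃ p ∈ P, p.1 = c) {F : Finset W}
    (hF : F.card < k) (hD : ∀ p ∈ P, p.2 ∈ D ∨ p.2 ∈ F) {v : V}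
    (hv : ∀ p ∈ P, ¬ Near G (2 ^ i) p.1 v) : ∃ w, LocalEF G H i (insert (v, w) P) := by
  -- Since `i ≤ k - 1`, the depth bound `2 ^ (k - 1)` in `TreeRich` covers all the balls that occur.
  have hle : 2 ^ i ≤ 2 ^ (k - 1) := Nat.pow_le_pow_right (by norm_num) (by omega)
  have htree := hG.isTree_ball i hi v fun c hc hcv => by
    obtain ⟨p, hp, rfl⟩ := hC c hc
    exact hv p hp hcv
  obtain ⟨B, K, f, b, hEF, hclosed, hdisj⟩ := hH.exists_component _ _ (ballRoot G _ v) htree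
    (fun a => (near_induce_ball a).mono ((Nat.sub_le _ _).trans hle)) F hF
  have hmem : ∀ n x, Near H n (f b) x → x ∈ Set.range f :=
    fun n x hx => hx.mem_of_closed hclosed ⟨b, rfl⟩
  have hloc : LocalEF G H i {(v, f b)} := by
    have := (hEF.of_le hi.le).localEF (SimpleGraph.Embedding.induce _) f ?_ ?_
    · simpa [ballRoot] using this
    · rintro _ rfl x hx
      exact ⟨⟨x, edist_le_iff_near.2 hx⟩, rfl⟩
    · rintro _ rfl x hx
      exact hmem _ x hx
  have hfar : ∀ p ∈ P, ∀ n, ¬ Near H n p.2 (f b) := by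
    intro p hp n hn
    have := hdisj _ (hmem n _ hn.symm)
    have := hD p hp
    tauto
  refine ⟨f b, ?_⟩
  -- Two groups, indexed by `Bool`: the new pair and the old position.
  have := LocalEF.iUnion (G := G) (H := H) (n := i)
    (P := fun a : Bool => bif a then {(v, f b)} else P) (by simp [hloc, hP]) ?_ ?_
  · convert this using 1
    ext q
    simp [Set.mem_iUnion, or_comm]
  · rintro (_ | _) (_ | _) hab p hp q hq
    · exact (hab rfl).elim
    · cases hq
      exact hv p hp
    · cases hp
      exact fun h => hv q hq h.symm
    · exact (hab rfl).elim
  · rintro (_ | _) (_ | _) hab p hp q hq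
    · exact (hab rfl).elim
    · cases hq
      exact hfar p hp _
    · cases hp
      exact fun h => hfar q hq _ h.symm
    · exact (hab rfl).elim

/-- Two tree-rich graphs with locally equivalent cores are equivalent. -/
theorem TreeRich.ef (hG : TreeRich k G C) (hH : TreeRich k H D) {i : ℕ} {P : Set (V × W)}
    {F : Finset (V × W)} (hF : F.card + i ≤ k) (hP : LocalEF G H i P)
    (hC : ∀ c ∈ C, ∃ p ∈ P, p.1 = c) (hD : ∀ d ∈ D, ∃ p ∈ P, p.2 = d)
    (hPF : ∀ p ∈ P, (p.1 ∈ C ∧ p.2 ∈ D) ∨ p ∈ F) : EF G H i P := by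
  classical
  induction i generalizing P F with
  | zero => exact hP
  | succ i ih =>
    -- `F` records the pairs added by moves. It grows by at most one in each round, so it has fewer
    -- than `k` elements whenever a move remains, even if `P` is infinite.
    have step : ∀ v w, LocalEF G H i (insert (v, w) P) → EF G H i (insert (v, w) P) := by
      intro v w h
      refine ih (F := insert (v, w) F) ?_ h ?_ ?_ ?_
      · have := F.card_insert_le (v, w)
        omega
      · exact fun c hc => (hC c hc).imp fun p hp => ⟨.inr hp.1, hp.2⟩
      · exact fun d hd => (hD d hd).imp fun p hp => ⟨.inr hp.1, hp.2⟩
      · rintro p (rfl | hp)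
        · exact .inr (F.mem_insert_self _)
        · exact (hPF p hp).imp id fun h => Finset.mem_insert_of_mem h
    refine ⟨hP.partialIso, fun v => ?_, fun w => ?_⟩
    · suffices h : ∃ w, LocalEF G H i (insert (v, w) P) from h.imp fun w => step v w
      by_cases hv : ∃ p ∈ P, Near G (2 ^ i) p.1 v
      · obtain ⟨p, hp, hpv⟩ := hv
        exact (hP.2.1 p hp v hpv).imp fun w hw => hw.2
      · refine hG.exists_response hH (by omega) hP.of_succ hC (F := F.image Prod.snd) ?_ ?_
          fun p hp h => hv ⟨p, hp, h⟩
        · have := F.card_image_le (f := Prod.snd)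
          omega
        · exact fun p hp => (hPF p hp).imp (·.2) fun h => Finset.mem_image_of_mem _ h
    · suffices h : ∃ v, LocalEF G H i (insert (v, w) P) from h.imp fun v => step v w
      by_cases hw : ∃ p ∈ P, Near H (2 ^ i) p.2 w
      · obtain ⟨p, hp, hpw⟩ := hw
        exact (hP.2.2 p hp w hpw).imp fun v hv => hv.2
      · obtain ⟨v, hv⟩ := hH.exists_response hG (i := i) (by omega) hP.of_succ.swap
          (F := F.image Prod.fst) (v := w)
          (fun d hd => by
            obtain ⟨p, hp, rfl⟩ := hD d hd
            exact ⟨p.swap, hp, rfl⟩)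
          (by
            have := F.card_image_le (f := Prod.fst)
            omega)
          (fun p hp => (hPF p.swap hp).imp (·.1) fun h => Finset.mem_image_of_mem Prod.fst h)
          (fun p hp h => hw ⟨p.swap, hp, h⟩)
        have := hv.swap
        rw [swap_preimage_insert] at this
        exact ⟨v, this⟩

/-! ### Tree-richness of graphs with many tree neighborhoods -/

theorem two_pow_le_radius (k : ℕ) : 2 ^ k ≤ radius k := by
  have : 2 * 2 ^ k ≤ 3 ^ k + 1 := by
    induction k with
    | zero => norm_num
    | succ k ih =>
      have : 1 ≤ 3 ^ k := Nat.one_le_pow _ _ (by norm_num)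
      rw [pow_succ, pow_succ]
      omega
  unfold radius
  omega

theorem two_pow_lt_radius {i k : ℕ} (h : i < k) : 2 ^ i < radius k :=
  (Nat.pow_lt_pow_right (by norm_num) h).trans_le (two_pow_le_radius k)

/-- A ball without cycles that are short and close to its center is a tree. -/
theorem isTree_induce_ball {m : ℕ} {v : V}
    (h : ∀ (y : V) (c : G.Walk y y), c.IsCycle → c.length ≤ 2 * m + 1 → ¬ Near G m y v) :
    (G.induce (ball G m v)).IsTree := by
  refine ⟨SimpleGraph.connected_iff_exists_forall_reachable _ |>.2 ⟨ballRoot G m v, fun w => ?_⟩,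
    fun x c hc => ?_⟩
  · exact (near_induce_ball w).choose.reachable
  · have hc' := (SimpleGraph.Walk.isCycle_map_iff_of_injective
      (f := (SimpleGraph.Embedding.induce (ball G m v)).toHom) Subtype.val_injective).2 hc
    obtain ⟨y, d, hd, hl, hy⟩ := exists_short_cycle (v := v) (m := m) hc' fun z hz => by
      rw [SimpleGraph.Walk.support_map, List.mem_map] at hz
      obtain ⟨z, -, rfl⟩ := hz
      exact (near_of_mem_ball z.2).symm
    exact h y d hd hl hy

theorem mem_sUnion_shortCycles {r : ℕ} {y : V} (c : G.Walk y y) (hc : c.IsCycle)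
    (hl : c.length ≤ 2 * r) : y ∈ ⋃₀ shortCycles G r :=
  ⟨_, ⟨y, c, hc, hl, rfl⟩, c.start_mem_support⟩

/-- The slack between the depth `2 ^ (k - 1)` and the radius turns the required balls into entire
components, so that distinct balls are disjoint. -/
theorem HasManyTrees.treeRich (hG : HasManyTrees k G) :
    TreeRich k G (⋃₀ shortCycles G (radius k)) where
  isTree_ball i hi v hv := by
    have h1 : 1 ≤ 2 ^ i := Nat.one_le_two_pow
    have h2 := two_pow_lt_radius hi
    refine isTree_induce_ball fun y c hc hl hy => hv y ?_ (hy.mono (by omega))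
    exact mem_sUnion_shortCycles c hc (by omega)
  exists_component A T t hT hdepth F hF := by
    obtain ⟨k, rfl⟩ : ∃ j, k = j + 1 := Nat.exists_eq_succ_of_ne_zero (by omega)
    have hr := two_pow_lt_radius k.lt_succ_self
    rw [Nat.add_sub_cancel] at hdepth
    have hmany := hG A T t hT fun a => edist_le_iff_near.2 ((hdepth a).mono hr.le)
    set L := rootedLogicalType (k + 1) T t
    have hball : ∀ v, rootedLogicalType (k + 1) (G.induce (ball G (radius (k + 1)) v))
        (ballRoot G (radius (k + 1)) v) = L → ∀ x ∈ ball G (radius (k + 1)) v, ∀ y,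
        G.Adj x y → y ∈ ball G (radius (k + 1)) v := by
      intro v hv x hx y hxy
      have hEF := EF.of_rootedLogicalType_eq hv.symm
      obtain ⟨a, ha⟩ := hEF.2.2 ⟨x, hx⟩
      -- Here `k + 1` rounds are available. After `x` is played `k` are left, so `x` inherits from
      -- `a` the distance bound `2 ^ k`, below the radius; a neighbor of `x` is then still in the
      -- ball.
      have h1 := ha.near (p := (t, _)) (q := (a, _)) (.inr rfl) (.inl rfl) (hdepth a)
      have h2 := h1.map (SimpleGraph.Embedding.induce _).toHom
      exact edist_le_iff_near.2 (h2.trans hxy.near hr)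
    obtain ⟨_, ⟨v, hv, rfl, hvL⟩, hvF⟩ : ∃ B ∈ treeNeighborhoods (k + 1) G L, ∀ x ∈ B, x ∉ F := by
      by_contra! hcon
      -- If every such ball met `F`, each would be the component of an element of `F`, and there
      -- would be at most `F.card` of them, too few.
      have hsub : treeNeighborhoods (k + 1) G L ⊆ (fun x => {y | G.Reachable x y}) '' (F : Set V) := by
        intro B hB
        obtain ⟨x, hx, hxF⟩ := hcon B hB
        obtain ⟨v, -, rfl, hvL⟩ := hB
        refine ⟨x, hxF, Set.ext fun y => ⟨?_, fun hy => ?_⟩⟩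
        · rintro ⟨p⟩
          exact Near.mem_of_closed (hball v hvL) ⟨p, le_rfl⟩ hx
        · exact (near_of_mem_ball hx).choose.reachable.symm.trans
            (near_of_mem_ball hy).choose.reachable
      have := hmany.trans ((Set.encard_le_encard hsub).trans (Set.encard_image_le _ _))
      rw [Set.encard_coe_eq_coe_finsetCard] at this
      exact absurd (by exact_mod_cast this) (not_le.2 hF)
    refine ⟨_, _, SimpleGraph.Embedding.induce (ball G (radius (k + 1)) v), ballRoot G _ v,
      EF.of_rootedLogicalType_eq hvL.symm, ?_, ?_⟩
    · rintro _ ⟨x, rfl⟩ y hxy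
      exact ⟨⟨y, hball v hvL _ x.2 y hxy⟩, rfl⟩
    · rintro _ ⟨x, rfl⟩
      refine ⟨?_, hvF _ x.2⟩
      rintro ⟨c, hc, hxc⟩
      exact Set.disjoint_left.1 (hv c hc) x.2 hxc

end TreeRich

/-! ### Disjoint unions -/

section Sigma
variable {ι κ : Type*} {A : ι → Type*} {B : κ → Type*}

/-- The disjoint union of a family of graphs. -/
def sigmaGraph (K : ∀ i, SimpleGraph (A i)) : SimpleGraph (Σ i, A i) where
  Adj p q := ∃ i x y, (K i).Adj x y ∧ p = ⟨i, x⟩ ∧ q = ⟨i, y⟩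
  symm := ⟨fun _ _ ⟨i, x, y, h, hp, hq⟩ => ⟨i, y, x, h.symm, hq, hp⟩⟩
  loopless := ⟨by
    rintro _ ⟨i, x, y, h, rfl, hq⟩
    cases hq
    exact (K i).loopless.irrefl _ h⟩

variable {K : ∀ i, SimpleGraph (A i)} {L : ∀ j, SimpleGraph (B j)}

/-- The embedding of a member of the family into the disjoint union. -/
def sigmaPiece (K : ∀ i, SimpleGraph (A i)) (i : ι) : K i ↪g sigmaGraph K where
  toFun x := ⟨i, x⟩
  inj' _ _ h := eq_of_heq (Sigma.mk.inj h).2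
  map_rel_iff' {x y} := by
    constructor
    · rintro ⟨j, x', y', h, h1, h2⟩
      cases h1
      cases h2
      exact h
    · exact fun h => ⟨i, x, y, h, rfl, rfl⟩

theorem sigmaGraph_adj_mk {i : ι} {x y : A i} :
    (sigmaGraph K).Adj ⟨i, x⟩ ⟨i, y⟩ ↔ (K i).Adj x y :=
  (sigmaPiece K i).map_adj_iff

theorem sigmaPiece_closed (i : ι) :
    ∀ p ∈ Set.range (sigmaPiece K i), ∀ q, (sigmaGraph K).Adj p q →
      q ∈ Set.range (sigmaPiece K i) := by
  rintro _ ⟨x, rfl⟩ q ⟨j, a, b, h, h1, rfl⟩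
  cases h1
  exact ⟨b, rfl⟩

theorem mem_range_sigmaPiece {i : ι} {p : Σ i, A i} : p ∈ Set.range (sigmaPiece K i) ↔ p.1 = i := by
  constructor
  · rintro ⟨x, rfl⟩
    rfl
  · rintro rfl
    exact ⟨p.2, rfl⟩

theorem Near.fst_eq {n : ℕ} {p q : Σ i, A i} (h : Near (sigmaGraph K) n p q) : q.1 = p.1 :=
  mem_range_sigmaPiece.1 (h.mem_of_closed (sigmaPiece_closed p.1) (mem_range_sigmaPiece.2 rfl))

/-- The part of a position that lies in the pieces `i` and `j`. -/
def fiber (P : Set ((Σ i, A i) × Σ j, B j)) (i : ι) (j : κ) : Set (A i × B j) :=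
  {p | (⟨i, p.1⟩, ⟨j, p.2⟩) ∈ P}

/-- A position between two disjoint unions in which the pieces visited so far are matched with
pieces of the same class and Duplicator wins the game of `n` rounds on all matching pieces. -/
structure SigmaPosition {τ : Type*} (c : ι → τ) (d : κ → τ) (K : ∀ i, SimpleGraph (A i))
    (L : ∀ j, SimpleGraph (B j)) (n : ℕ) (P : Set ((Σ i, A i) × Σ j, B j)) : Prop where
  finite : P.Finite
  matched : ∀ p ∈ P, ∀ q ∈ P, p.1.1 = q.1.1 ↔ p.2.1 = q.2.1
  class_eq : ∀ p ∈ P, c p.1.1 = d p.2.1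
  ef : ∀ i j, c i = d j → (∀ p ∈ P, p.1.1 = i ↔ p.2.1 = j) → EF (K i) (L j) n (fiber P i j)

variable {τ : Type*} {c : ι → τ} {d : κ → τ} {n : ℕ} {P : Set ((Σ i, A i) × Σ j, B j)}

theorem SigmaPosition.swap (h : SigmaPosition c d K L n P) :
    SigmaPosition d c L K n (Prod.swap ⁻¹' P) where
  finite := h.finite.preimage Prod.swap_injective.injOn
  matched p hp q hq := (h.matched _ hp _ hq).symm
  class_eq p hp := (h.class_eq _ hp).symm
  ef j i hij hP := (h.ef i j hij.symm fun p hp => (hP p.swap (by simpa using hp)).symm).swap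

theorem SigmaPosition.partialIso (h : SigmaPosition c d K L n P) :
    PartialIso (sigmaGraph K) (sigmaGraph L) P := by
  rintro ⟨⟨i, a⟩, ⟨j, b⟩⟩ hp ⟨⟨i', a'⟩, ⟨j', b'⟩⟩ hq
  have hm : i = i' ↔ j = j' := h.matched _ hp _ hq
  by_cases hi : i = i'
  · obtain rfl := hi
    obtain rfl := hm.1 rfl
    have := (h.ef i j (h.class_eq _ hp) fun q hq => h.matched q hq _ hp).partialIso
      (a, b) hp (a', b') hq
    simpa [sigmaGraph_adj_mk] using this
  · have hj : j ≠ j' := mt hm.2 hi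
    have h1 : ¬ (sigmaGraph K).Adj ⟨i, a⟩ ⟨i', a'⟩ := fun h => hi (Near.fst_eq h.near).symm
    have h2 : ¬ (sigmaGraph L).Adj ⟨j, b⟩ ⟨j', b'⟩ := fun h => hj (Near.fst_eq h.near).symm
    simp [hi, hj, h1, h2]

/-- A visited piece keeps its partner. For a new piece `i`, an unvisited piece of the same class
must exist on the other side: otherwise that whole class is matched with visited pieces on the side
of `i`, which are finitely many and do not include `i`, against the equality of the counts. -/
theorem SigmaPosition.exists_match (h : SigmaPosition c d K L n P)
    (hcard : ∀ t, {i | c i = t}.encard = {j | d j = t}.encard) (i : ι) :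
    ∃ j, c i = d j ∧ ∀ p ∈ P, p.1.1 = i ↔ p.2.1 = j := by
  by_cases hi : ∃ p ∈ P, p.1.1 = i
  · obtain ⟨p, hp, rfl⟩ := hi
    exact ⟨p.2.1, h.class_eq p hp, fun q hq => h.matched q hq p hp⟩
  push Not at hi
  by_contra! hcon
  let S := {p ∈ P | c p.1.1 = c i}
  -- `U` keeps one pair for each visited index of the class of `i`, so that pieces rather than
  -- vertices are counted.
  obtain ⟨U, hUS, hinj, hU⟩ := (Set.surjOn_image (fun p => p.1.1) S).exists_subset_injOn_image_eq
  have hsub : {j | d j = c i} ⊆ (fun p => p.2.1) '' U := by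
    intro j hj
    obtain ⟨p, hp, hpj⟩ := hcon j (Eq.symm hj)
    have hpj : p.2.1 = j := by
      have := hi p hp
      tauto
    have hpS : p ∈ S := ⟨hp, by rw [h.class_eq p hp, hpj]; exact hj⟩
    obtain ⟨q, hq, hqp⟩ : p.1.1 ∈ (fun p => p.1.1) '' U := hU ▸ ⟨p, hpS, rfl⟩
    exact ⟨q, hq, ((h.matched q (hUS hq).1 p hp).1 hqp).trans hpj⟩
  have hsup : insert i ((fun p => p.1.1) '' U) ⊆ {i' | c i' = c i} := by
    rintro _ (rfl | ⟨p, hp, rfl⟩)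
    · rfl
    · exact (hUS hp).2
  have hfin : ((fun p => p.1.1) '' U).Finite := (h.finite.subset fun p hp => (hUS hp).1).image _
  have hni : i ∉ (fun p => p.1.1) '' U := by
    rintro ⟨p, hp, hpi⟩
    exact hi p (hUS hp).1 hpi
  have h1 := Set.encard_le_encard hsup
  have h2 := (Set.encard_le_encard hsub).trans (Set.encard_image_le _ _)
  rw [Set.encard_insert_of_notMem hni, hcard] at h1
  rw [← hinj.encard_image] at h2
  exact absurd (h1.trans h2) (not_le.2 ((ENat.lt_add_one_iff hfin.encard_lt_top.ne).2 le_rfl))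

theorem SigmaPosition.exists_response (h : SigmaPosition c d K L (n + 1) P)
    (hcard : ∀ t, {i | c i = t}.encard = {j | d j = t}.encard) (v : Σ i, A i) :
    ∃ w, SigmaPosition c d K L n (insert (v, w) P) := by
  obtain ⟨i, a⟩ := v
  obtain ⟨j, hij, hm⟩ := h.exists_match hcard i
  -- If neither piece has been visited, the fiber is empty and this is the first move of their game.
  -- The games on the other pieces only lose a round.
  obtain ⟨b, hb⟩ := (h.ef i j hij hm).2.1 a
  refine ⟨⟨j, b⟩, h.finite.insert _, ?_, ?_, fun i' j' hij' hm' => ?_⟩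
  · rintro p (rfl | hp) q (rfl | hq)
    · simp
    · simpa [eq_comm] using hm q hq
    · exact hm p hp
    · exact h.matched p hp q hq
  · rintro p (rfl | hp)
    · exact hij
    · exact h.class_eq p hp
  · have hnew : i = i' ↔ j = j' := hm' _ (.inl rfl)
    by_cases hi : i = i'
    · obtain rfl := hi
      obtain rfl := hnew.1 rfl
      convert hb using 1
      ext ⟨a', b'⟩
      simp [fiber]
    · have hj := mt hnew.2 hi
      convert (h.ef i' j' hij' fun p hp => hm' p (.inr hp)).of_succ using 1
      ext ⟨a', b'⟩
      simp [fiber, Ne.symm hi]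

theorem SigmaPosition.sigma_ef (h : SigmaPosition c d K L n P)
    (hcard : ∀ t, {i | c i = t}.encard = {j | d j = t}.encard) :
    EF (sigmaGraph K) (sigmaGraph L) n P := by
  induction n generalizing P with
  | zero => exact h.partialIso
  | succ n ih =>
    refine ⟨h.partialIso, fun v => ?_, fun w => ?_⟩
    · exact (h.exists_response hcard v).imp fun w hw => ih hw
    · obtain ⟨v, hv⟩ := h.swap.exists_response (fun t => (hcard t).symm) w
      exact ⟨v, ih (swap_preimage_insert w v (Prod.swap ⁻¹' P) ▸ hv.swap)⟩

/-- Disjoint unions with the same number of pieces of each class are equivalent. -/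
theorem EF.sigma {k : ℕ} (hcard : ∀ t, {i | c i = t}.encard = {j | d j = t}.encard)
    (h : ∀ i j, c i = d j → EF (K i) (L j) k ∅) : EF (sigmaGraph K) (sigmaGraph L) k ∅ := by
  refine SigmaPosition.sigma_ef (c := c) (d := d) ⟨Set.finite_empty, by simp, by simp, ?_⟩ hcard
  intro i j hij _
  simpa [fiber] using h i j hij

end Sigma

/-! ### Clusters of short cycles -/

section Clusters
variable {V : Type*} {G : SimpleGraph V} {r : ℕ}

theorem CyclesNear.symm {C C' : Set V} (h : CyclesNear G r C C') : CyclesNear G r C' C := by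
  obtain ⟨hC, hC', x, hx, y, hy, hxy⟩ := h
  exact ⟨hC', hC, y, hy, x, hx, by rwa [SimpleGraph.edist_comm]⟩

theorem CyclesLinked.symm {C C' : Set V} (h : CyclesLinked G r C C') : CyclesLinked G r C' C :=
  have : Std.Symm (CyclesNear G r) := ⟨fun _ _ h => CyclesNear.symm h⟩
  Relation.ReflTransGen.stdSymm.symm _ _ h

/-- Cycles through the two close points are themselves linked, which joins the two chains. Distinct
clusters are therefore more than `r` apart. -/
theorem cluster_eq_of_near {S S' : Set V} (hS : S ∈ cycleClusters G r)
    (hS' : S' ∈ cycleClusters G r) {x y : V} (hx : x ∈ S) (hy : y ∈ S') (h : Near G r x y) :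
    S = S' := by
  obtain ⟨C, hC, rfl⟩ := hS
  obtain ⟨C', hC', rfl⟩ := hS'
  obtain ⟨D, ⟨hD, hCD⟩, hxD⟩ := hx
  obtain ⟨D', ⟨hD', hCD'⟩, hyD'⟩ := hy
  have hDD' : CyclesLinked G r D D' :=
    .single ⟨hD, hD', x, hxD, y, hyD', edist_le_iff_near.2 h⟩
  have hCC' : CyclesLinked G r C C' := (hCD.trans hDD').trans (CyclesLinked.symm hCD')
  congr 1
  ext E
  exact and_congr_right fun _ => ⟨(CyclesLinked.symm hCC').trans, hCC'.trans⟩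

theorem mem_cycleClusters_of_mem_shortCycles {C : Set V} (hC : C ∈ shortCycles G r) :
    ∃ S ∈ cycleClusters G r, C ⊆ S :=
  ⟨_, ⟨C, hC, rfl⟩, Set.subset_sUnion_of_mem ⟨hC, .refl⟩⟩

theorem subset_sUnion_shortCycles {S : Set V} (hS : S ∈ cycleClusters G r) :
    S ⊆ ⋃₀ shortCycles G r := by
  obtain ⟨C, -, rfl⟩ := hS
  exact Set.sUnion_subset_sUnion fun D hD => hD.1

/-- A short cycle through `x` lies in some cluster, and that cluster is within `r` of `S`. Hence
passing to the neighborhood of a cluster brings in no short cycle outside that cluster. -/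
theorem mem_of_mem_setBall {S : Set V} (hS : S ∈ cycleClusters G r) {x : V}
    (hx : x ∈ setBall G r S) (hx' : x ∈ ⋃₀ shortCycles G r) : x ∈ S := by
  obtain ⟨y, hy, hxy⟩ := hx
  obtain ⟨C, hC, hxC⟩ := hx'
  obtain ⟨S', hS', hCS'⟩ := mem_cycleClusters_of_mem_shortCycles hC
  rw [← cluster_eq_of_near hS' hS (hCS' hxC) hy (edist_le_iff_near.1 hxy)]
  exact hCS' hxC

end Clusters

/-! ### The disjoint union of the cluster neighborhoods and of trees of all classes -/

section Model

/-- The logical types of the rooted trees. -/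
def TreeType (k : ℕ) : Type :=
  {L : Set (Language.graph.Formula Unit) // ∃ (A : Type u) (T : SimpleGraph A) (t : A),
    T.IsTree ∧ rootedLogicalType k T t = L}

/-- The vertices of a representative of a tree type. -/
def TreeType.Carrier {k : ℕ} (L : TreeType.{u} k) : Type u := L.2.choose

/-- A representative of a tree type. -/
noncomputable def TreeType.tree {k : ℕ} (L : TreeType.{u} k) : SimpleGraph L.Carrier :=
  L.2.choose_spec.choose

/-- The root of the representative of a tree type. -/
noncomputable def TreeType.root {k : ℕ} (L : TreeType.{u} k) : L.Carrier :=
  L.2.choose_spec.choose_spec.choose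

theorem TreeType.isTree {k : ℕ} (L : TreeType.{u} k) : L.tree.IsTree :=
  L.2.choose_spec.choose_spec.choose_spec.1

theorem TreeType.rootedLogicalType_eq {k : ℕ} (L : TreeType.{u} k) :
    rootedLogicalType k L.tree L.root = L.1 :=
  L.2.choose_spec.choose_spec.choose_spec.2

variable {V W : Type u} (k : ℕ) (G : SimpleGraph V)

/-- The pieces of the model: the clusters, and infinitely many trees of each type. -/
abbrev ModelIndex : Type u := cycleClusters G (radius k) ⊕ (ℕ × TreeType.{u} k)

/-- The vertices of the pieces of the model. -/
def ModelCarrier : ModelIndex k G → Type u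
  | .inl S => setBall G (radius k) S.1
  | .inr z => z.2.Carrier

/-- The pieces of the model. -/
noncomputable def modelPiece : ∀ i : ModelIndex k G, SimpleGraph (ModelCarrier k G i)
  | .inl S => G.induce (setBall G (radius k) S.1)
  | .inr z => z.2.tree

/-- The vertices of the model that come from clusters. -/
def modelCore : Set (Σ i, ModelCarrier k G i) :=
  {p | ∃ (S : cycleClusters G (radius k)) (x : setBall G (radius k) S.1), x.1 ∈ S.1 ∧
    p = ⟨.inl S, x⟩}

variable {k G}

/-- A cycle stays in one piece. Tree pieces have none, and short ones in a cluster neighborhood lie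
in the cluster by `mem_of_mem_setBall`. Fresh components come from the infinitely many copies of
each tree. -/
theorem treeRich_model : TreeRich k (sigmaGraph (modelPiece k G)) (modelCore k G) where
  isTree_ball i hi v hv := by
    have h1 : 1 ≤ 2 ^ i := Nat.one_le_two_pow
    have h2 := two_pow_lt_radius hi
    refine isTree_induce_ball fun y c hc hl hy => ?_
    obtain ⟨b, c', hb, hc', hl'⟩ := exists_isCycle_preimage (sigmaPiece (modelPiece k G) y.1) hc
      fun z hz => (Near.of_mem_support c hz).mem_of_closed (sigmaPiece_closed y.1)
        (mem_range_sigmaPiece.2 rfl)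
    obtain ⟨S | z, x⟩ := y
    · refine hv _ ⟨S, b, ?_, hb.symm⟩ (hy.mono (by omega))
      have hc'' := (SimpleGraph.Walk.isCycle_map_iff_of_injective
        (f := (SimpleGraph.Embedding.induce (G := G) (setBall G (radius k) S.1)).toHom)
        Subtype.val_injective).2 hc'
      refine mem_of_mem_setBall S.2 b.2 (mem_sUnion_shortCycles _ hc'' ?_)
      have h3 : c'.length ≤ 2 * radius k := by omega
      exact (SimpleGraph.Walk.length_map _ _).trans_le h3
    · exact z.2.isTree.isAcyclic c' hc'
  exists_component A T t hT _ F _ := by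
    classical
    let L : TreeType.{u} k := ⟨rootedLogicalType k T t, A, T, t, hT, rfl⟩
    -- `n` is a copy number that no vertex of `F` uses; the value `0` for vertices of cluster pieces
    -- is a dummy.
    obtain ⟨n, hn⟩ := Infinite.exists_notMem_finset
      (F.image fun p => Sum.elim (fun _ => 0) Prod.fst p.1)
    refine ⟨_, _, sigmaPiece (modelPiece k G) (.inr (n, L)), L.root,
      EF.of_rootedLogicalType_eq L.rootedLogicalType_eq.symm, sigmaPiece_closed _, ?_⟩
    rintro _ ⟨x, rfl⟩
    refine ⟨?_, fun hx => hn (Finset.mem_image.2 ⟨_, hx, rfl⟩)⟩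
    rintro ⟨S, y, -, h⟩
    cases h

/-- The cores of the graph and of the model are identified by the identity on every cluster. This
wins the local game, and tree-richness of both sides handles the rest. -/
theorem HasManyTrees.ef_model (hG : HasManyTrees k G) :
    EF G (sigmaGraph (modelPiece k G)) k ∅ := by
  let P : cycleClusters G (radius k) → Set (V × Σ i, ModelCarrier k G i) := fun S =>
    Prod.map (SimpleGraph.Embedding.induce (G := G) (setBall G (radius k) S.1))
      (sigmaPiece (modelPiece k G) (.inl S)) ''
      {p : setBall G (radius k) S.1 × setBall G (radius k) S.1 | p.1 = p.2 ∧ p.1.1 ∈ S.1}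
  have hmem : ∀ S p, p ∈ P S ↔
      ∃ x : setBall G (radius k) S.1, x.1 ∈ S.1 ∧ p = (x.1, ⟨.inl S, x⟩) := by
    intro S p
    constructor
    · rintro ⟨⟨x, y⟩, ⟨hxy, hx⟩, rfl⟩
      obtain rfl : x = y := hxy
      exact ⟨x, hx, rfl⟩
    · rintro ⟨x, hx, rfl⟩
      exact ⟨(x, x), ⟨rfl, hx⟩, rfl⟩
  have hr := two_pow_le_radius k
  have hloc : LocalEF G (sigmaGraph (modelPiece k G)) k (⋃ S, P S) := by
    refine LocalEF.iUnion (fun S => ?_) ?_ ?_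
    · refine EF.localEF _ _ (EF.of_iso .refl k fun p hp => hp.1.symm) ?_ ?_
      · rintro p ⟨-, hx⟩ y hy
        -- The neighborhood of the cluster has radius at least `2 ^ k`, so it contains the balls of
        -- radius `2 ^ k - 1` needed for `k` local rounds.
        exact ⟨⟨y, p.1.1, hx, edist_le_iff_near.2 (hy.symm.mono (by omega))⟩, rfl⟩
      · rintro p - y hy
        exact hy.mem_of_closed (sigmaPiece_closed _) ⟨_, rfl⟩
    · intro S S' hSS' p hp q hq h
      obtain ⟨x, hx, rfl⟩ := (hmem _ _).1 hp
      obtain ⟨y, hy, rfl⟩ := (hmem _ _).1 hq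
      exact hSS' (Subtype.ext (cluster_eq_of_near S.2 S'.2 hx hy (h.mono hr)))
    · intro S S' hSS' p hp q hq h
      obtain ⟨x, hx, rfl⟩ := (hmem _ _).1 hp
      obtain ⟨y, hy, rfl⟩ := (hmem _ _).1 hq
      exact hSS' (Sum.inl.inj h.fst_eq).symm
  -- No move has been made yet, so `F` is empty and all `k` rounds remain. The pairs of core
  -- vertices are discarded at the end.
  refine (hG.treeRich.ef treeRich_model (F := ∅) (by simp) hloc ?_ ?_ ?_).mono
    (Set.empty_subset _)
  · rintro x ⟨C, hC, hx⟩
    obtain ⟨S, hS, hCS⟩ := mem_cycleClusters_of_mem_shortCycles hC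
    have hxS : x ∈ setBall G (radius k) S :=
      ⟨x, hCS hx, edist_le_iff_near.2 (Near.refl _ _)⟩
    exact ⟨_, Set.mem_iUnion.2 ⟨⟨S, hS⟩, (hmem _ _).2 ⟨⟨x, hxS⟩, hCS hx, rfl⟩⟩, rfl⟩
  · rintro _ ⟨S, x, hx, rfl⟩
    exact ⟨_, Set.mem_iUnion.2 ⟨S, (hmem _ _).2 ⟨x, hx, rfl⟩⟩, rfl⟩
  · intro p hp
    obtain ⟨S, hp⟩ := Set.mem_iUnion.1 hp
    obtain ⟨x, hx, rfl⟩ := (hmem _ _).1 hp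
    exact .inl ⟨subset_sUnion_shortCycles S.2 hx, S, x, hx, rfl⟩

variable (k G) in
/-- The class of a piece of the model. -/
def modelClass (i : ModelIndex k G) : Set Language.graph.Sentence ⊕ (ℕ × TreeType.{u} k) :=
  i.map (fun S => logicalType k (G.induce (setBall G (radius k) S.1))) id

theorem encard_modelClass_inl (L : Set Language.graph.Sentence) :
    {i | modelClass k G i = .inl L}.encard = cycleCount k G L := by
  have h1 : {i | modelClass k G i = .inl L} =
      Sum.inl '' {S | logicalType k (G.induce (setBall G (radius k) S.1)) = L} := by
    ext (S | z) <;> simp [modelClass]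
  have h2 : {S | S ∈ cycleClusters G (radius k) ∧
      logicalType k (G.induce (setBall G (radius k) S)) = L} =
      Subtype.val '' {S : cycleClusters G (radius k) |
        logicalType k (G.induce (setBall G (radius k) S.1)) = L} := by
    ext S
    simp [and_comm]
  rw [cycleCount, h1, h2, Sum.inl_injective.encard_image, Subtype.val_injective.encard_image]

theorem encard_modelClass_inr (z : ℕ × TreeType.{u} k) :
    {i | modelClass k G i = .inr z}.encard = 1 := by
  have : {i | modelClass k G i = .inr z} = {.inr z} := by
    ext (S | z) <;> simp [modelClass]
  rw [this, Set.encard_singleton]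

/-- Cluster pieces are classified by logical type, and the profile equates their counts. Each tree
piece forms a class of its own and is matched with the identical piece of the other model. -/
theorem SameCycleProfile.ef_model {G' : SimpleGraph W} (h : SameCycleProfile k G G') :
    EF (sigmaGraph (modelPiece k G)) (sigmaGraph (modelPiece k G')) k ∅ := by
  refine EF.sigma (c := modelClass k G) (d := modelClass k G') ?_ ?_
  · rintro (L | z)
    · rw [encard_modelClass_inl, encard_modelClass_inl, h L]
    · rw [encard_modelClass_inr, encard_modelClass_inr]
  · rintro (S | z) (S' | z') hij
    · exact EF.of_logicalType_eq (Sum.inl.inj hij)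
    · cases hij
    · cases hij
    · obtain rfl : z = z' := Sum.inr.inj hij
      exact EF.of_iso (G := z.2.tree) (H := z.2.tree) .refl k fun p hp => hp.elim

end Model
end CycleProfile

theorem lemma3 {V W : Type u} (k : ℕ) (G : SimpleGraph V) (G' : SimpleGraph W)
    (hcycles : CycleProfile.SameCycleProfile k G G')
    (htrees : CycleProfile.HasManyTrees k G) (htrees' : CycleProfile.HasManyTrees k G') :
    CycleProfile.ElemEquiv k G G' := fun φ hφ =>
  (htrees.ef_model.elemEquiv φ hφ).trans
    ((hcycles.ef_model.elemEquiv φ hφ).trans (htrees'.ef_model.elemEquiv φ hφ).symm)
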